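/- Let $\mathbb P$ be a set of propositional variables, and let $\mathcal L$ be the set of formulas generated by $$\varphi,\psi ::= p \mid \bot \mid \varphi\wedge\psi \mid \varphi\vee\psi \mid \varphi\to\psi \mid \bigcirc\varphi \mid \Diamond\varphi \mid \Box\varphi \qquad (p\in\mathbb P).$$ Write $|\mathrm{sub}(\varphi)|$ for the number of distinct subformulas of $\varphi$ (including $\varphi$). An intuitionistic dynamic model is a tuple $\mathcal M=(W,\preccurlyeq,S,V)$ where $(W,\preccurlyeq)$ is a non-empty poset, $S\colon W\to W$ satisfies $w\preccurlyeq v\Rightarrow S(w)\preccurlyeq S(v)$, and $V\colon W\to 2^{\mathbb P}$ satisfies $w\preccurlyeq v\Rightarrow V(w)\subseteq V(v)$. Satisfaction is defined by: $\mathcal M,w\models p$ iff $p\in V(w)$; $\mathcal M,w\models\bot$ never; $\wedge,\vee$ are evaluated pointwise; $\mathcal M,w\models\varphi\to\psi$ iff for all $v\succcurlyeq w$, $\mathcal M,v\models\varphi$ implies $\mathcal M,v\models\psi$; $\mathcal M,w\models\bigcirc\varphi$ iff $\mathcal M,S(w)\models\varphi$; $\mathcal M,w\models\Diamond\varphi$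 iff $\mathcal M,S^k(w)\models\varphi$ for some $k\ge 0$; $\mathcal M,w\models\Box\varphi$ iff $\mathcal M,S^k(w)\models\varphi$ for all $k\ge 0$. A formula is satisfiable (resp. falsifiable) on $\mathcal M$ if it holds (resp. fails) at some world of $\mathcal M$. Define $E^n_k$ and $Q^n_k$ for $n,k\in\mathbb N$ by $E^n_0=Q^n_0=0$, $E^n_{k+1}=E^n_k+n\,2^{E^n_k}$ and $Q^n_{k+1}=1+E^n_kQ^n_k$, and put $$B(s)=Q^{2^{s+1}}_{s+3}\Bigl(2E^{2^s}_{s+1}+s\,Q^{2^s}_{s+1}\,E^{2^{s+1}}_{s+3}\Bigr).$$ Theorem (strong finite model property). The function $B\colon\mathbb N\to\mathbb N$ is computable, and it is non-elementary in the sense that for every fixed $k$ it eventually exceeds the tower of exponentials $s\mapsto 2^{2^{\cdot^{\cdot^{2^s}}}}$ with $k$ twos. Every formula $\varphi\in\mathcal L$ that is satisfiable (resp. falsifiable) on some intuitionistic dynamic model is satisfiable (resp. falsifiable) on an intuitionistic dynamic model with at most $B(|\mathrm{sub}(\varphi)|)$ worlds. -/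

import Mathlib

universe u v

namespace ITL

/-- Formulas of the temporal language over a set `P` of propositional variables. -/
inductive Formula (P : Type u) : Type u where
  | var (p : P) : Formula P
  | bot : Formula P
  | and (φ ψ : Formula P) : Formula P
  | or (φ ψ : Formula P) : Formula P
  | imp (φ ψ : Formula P) : Formula P
  | next (φ : Formula P) : Formula P
  | eventually (φ : Formula P) : Formula P
  | henceforth (φ : Formula P) : Formula P

namespace Formula

/-- The set of subformulas of a formula (the formula itself included). -/
def sub {P : Type u} : Formula P → Set (Formula P)
  | var p => {var p}
  | bot => {bot}
  | and φ ψ => {and φ ψ} ∪ (sub φ ∪ sub ψ)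
  | or φ ψ => {or φ ψ} ∪ (sub φ ∪ sub ψ)
  | imp φ ψ => {imp φ ψ} ∪ (sub φ ∪ sub ψ)
  | next φ => {next φ} ∪ sub φ
  | eventually φ => {eventually φ} ∪ sub φ
  | henceforth φ => {henceforth φ} ∪ sub φ

/-- There are finitely many subformulas, so that `Set.ncard` below is the true cardinality. -/
theorem sub_finite {P : Type u} (φ : Formula P) : (sub φ).Finite := by
  induction φ with
  | var p => exact Set.finite_singleton _
  | bot => exact Set.finite_singleton _
  | and φ ψ h₁ h₂ => exact (Set.finite_singleton _).union (h₁.union h₂)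
  | or φ ψ h₁ h₂ => exact (Set.finite_singleton _).union (h₁.union h₂)
  | imp φ ψ h₁ h₂ => exact (Set.finite_singleton _).union (h₁.union h₂)
  | next φ h => exact (Set.finite_singleton _).union h
  | eventually φ h => exact (Set.finite_singleton _).union h
  | henceforth φ h => exact (Set.finite_singleton _).union h

/-- The number of (distinct) subformulas. -/
noncomputable def numSub {P : Type u} (φ : Formula P) : ℕ := (sub φ).ncard

end Formula

/-- An intuitionistic dynamic model: a non-empty poset with a forward confluent (that is,
monotone) function `succ` and a monotone valuation. -/
structure Model (P : Type u) : Type (max u (v + 1)) where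
  World : Type v
  nonempty : Nonempty World
  order : PartialOrder World
  succ : World → World
  confluent : ∀ w v : World, w ≤ v → succ w ≤ succ v
  val : World → Set P
  val_mono : ∀ w v : World, w ≤ v → val w ⊆ val v

attribute [instance] Model.order

/-- The satisfaction relation. -/
def Model.Sat {P : Type u} (M : Model.{u, v} P) : M.World → Formula P → Prop
  | w, .var p => p ∈ M.val w
  | _, .bot => False
  | w, .and φ ψ => M.Sat w φ ∧ M.Sat w ψ
  | w, .or φ ψ => M.Sat w φ ∨ M.Sat w ψ
  | w, .imp φ ψ => ∀ v, w ≤ v → M.Sat v φ → M.Sat v ψ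
  | w, .next φ => M.Sat (M.succ w) φ
  | w, .eventually φ => ∃ k : ℕ, M.Sat (M.succ^[k] w) φ
  | w, .henceforth φ => ∀ k : ℕ, M.Sat (M.succ^[k] w) φ

/-- `φ` is true at some world of `M`. -/
def Model.Satisfies {P : Type u} (M : Model.{u, v} P) (φ : Formula P) : Prop :=
  ∃ w : M.World, M.Sat w φ

/-- `φ` fails at some world of `M`. -/
def Model.Falsifies {P : Type u} (M : Model.{u, v} P) (φ : Formula P) : Prop :=
  ∃ w : M.World, ¬ M.Sat w φ

/-- `M` is finite and has at most `n` worlds. -/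
def Model.SizeAtMost {P : Type u} (M : Model.{u, v} P) (n : ℕ) : Prop :=
  Finite M.World ∧ Nat.card M.World ≤ n

/-- The quantity `E^n_k`. -/
def boundE (n : ℕ) : ℕ → ℕ
  | 0 => 0
  | k + 1 => boundE n k + n * 2 ^ boundE n k

/-- The quantity `Q^n_k`. -/
def boundQ (n : ℕ) : ℕ → ℕ
  | 0 => 0
  | k + 1 => 1 + boundE n k * boundQ n k

/-- The tower of exponentials `2^(2^(⋯^(2^s)))` with `k` twos. -/
def tower (k s : ℕ) : ℕ := (fun m : ℕ => 2 ^ m)^[k] s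

end ITL

namespace ITL

/-! Let `e` list the `m + 1` subformulas. Fix one of them, `e c`, and a deadline `K`, and label each
world by the listed formulas true there plus one bit: whether `e c` is settled (a `◇` fulfilled, a
`□` refuted) in fewer than `K` steps, complemented for `□` so that labels grow along the order.
Label chains are bounded, so the iterated neighbourhood types of level `m + 2` are finite in number
and already act as a bisimulation for label-changing steps upwards (`LayerType.exists_of_of_eq`).

A layer of the quotient is given by a tracked formula and a root type; its points are paths of types
with strictly growing labels, realised coherently by worlds of `M`, using the least deadline at
which the root type occurs. The dynamics takes the realised layer, applies `M.succ`, lowers the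
deadline by one and reads off types again. At deadline `0` the next formula, cyclically, gets a
deadline that suffices for the finitely many worlds of the image layer.

Representatives change at every step, but labels do not (`lab_next`). So the bit forces the tracked
formula to be settled before the countdown ends, and each formula is tracked again and again
(`exists_settles_toWorld_iff`). This yields the truth lemma `sat_iff`. A path is determined by its
set of types, hence at most `(m + 1) * T * 2 ^ T` worlds for `T` types, which is below the bound. -/

/-! ### Growth and computability of the bound. -/

theorem boundE_succ (n k : ℕ) : boundE n (k + 1) = boundE n k + n * 2 ^ boundE n k := rfl

theorem boundQ_succ (n k : ℕ) : boundQ n (k + 1) = 1 + boundE n k * boundQ n k := rfl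

theorem boundQ_succ_pos (n k : ℕ) : 0 < boundQ n (k + 1) := by
  rw [boundQ_succ]; omega

theorem boundE_mono (n : ℕ) : Monotone (boundE n) :=
  monotone_nat_of_le_succ fun k => by rw [boundE_succ]; exact Nat.le_add_right _ _

theorem two_pow_boundE_le {n : ℕ} (hn : 0 < n) (k : ℕ) : 2 ^ boundE n k ≤ boundE n (k + 1) := by
  rw [boundE_succ]
  exact (Nat.le_mul_of_pos_left _ hn).trans (Nat.le_add_left _ _)

theorem tower_succ (k s : ℕ) : tower (k + 1) s = 2 ^ tower k s :=
  Function.iterate_succ_apply' _ _ _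

theorem tower_le_boundE (k s : ℕ) : tower k s ≤ boundE (2 ^ (s + 1)) (k + 1) := by
  induction k with
  | zero =>
    simp only [tower, boundE, Function.iterate_zero, id]
    have : s + 1 < 2 ^ (s + 1) := Nat.lt_two_pow_self
    omega
  | succ k ih =>
    rw [tower_succ]
    exact (Nat.pow_le_pow_right two_pos ih).trans (two_pow_boundE_le (by positivity) _)

/-- The size bound of the strong finite model property. -/
def modelBound (s : ℕ) : ℕ :=
  boundQ (2 ^ (s + 1)) (s + 3) *
    (2 * boundE (2 ^ s) (s + 1) +
      s * boundQ (2 ^ s) (s + 1) * boundE (2 ^ (s + 1)) (s + 3))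

theorem le_modelBound (s : ℕ) :
    boundQ (2 ^ (s + 1)) (s + 3) * (s * boundE (2 ^ (s + 1)) (s + 3)) ≤ modelBound s := by
  refine Nat.mul_le_mul_left _ (le_trans ?_ (Nat.le_add_left _ _))
  refine Nat.mul_le_mul_right _ ?_
  exact Nat.le_mul_of_pos_right _ (boundQ_succ_pos _ _)

theorem eventually_tower_lt_modelBound (k : ℕ) :
    ∀ᶠ s : ℕ in Filter.atTop, tower k s < modelBound s := by
  filter_upwards [Filter.eventually_ge_atTop (k + 1)] with s hs
  calc tower k s ≤ boundE (2 ^ (s + 1)) (k + 1) := tower_le_boundE k s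
    _ < 2 ^ boundE (2 ^ (s + 1)) (k + 1) := Nat.lt_two_pow_self
    _ ≤ boundE (2 ^ (s + 1)) (k + 2) := two_pow_boundE_le (by positivity) _
    _ ≤ boundE (2 ^ (s + 1)) (s + 3) := boundE_mono _ (by omega)
    _ ≤ s * boundE (2 ^ (s + 1)) (s + 3) := Nat.le_mul_of_pos_left _ (by omega)
    _ ≤ boundQ (2 ^ (s + 1)) (s + 3) * (s * boundE (2 ^ (s + 1)) (s + 3)) :=
        Nat.le_mul_of_pos_left _ (boundQ_succ_pos _ _)
    _ ≤ modelBound s := le_modelBound s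

/-- The left side counts triples of a tracked formula, a root type and a set of types, for `s`
subformulas. -/
theorem mul_two_pow_le_modelBound (s : ℕ) :
    s * (boundE (2 ^ (s + 1)) (s + 2) * 2 ^ boundE (2 ^ (s + 1)) (s + 2)) ≤ modelBound s := by
  refine le_trans ?_ (le_modelBound s)
  have h₁ : boundE (2 ^ (s + 1)) (s + 2) ≤ boundQ (2 ^ (s + 1)) (s + 3) := by
    rw [boundQ_succ]
    exact (Nat.le_mul_of_pos_right _ (boundQ_succ_pos _ _)).trans (Nat.le_add_left _ _)
  have h₂ := two_pow_boundE_le (n := 2 ^ (s + 1)) (by positivity) (s + 2)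
  calc _ = boundE (2 ^ (s + 1)) (s + 2) * (s * 2 ^ boundE (2 ^ (s + 1)) (s + 2)) := by ring
    _ ≤ _ := Nat.mul_le_mul h₁ (Nat.mul_le_mul_left _ h₂)

theorem primrec_two_pow : Primrec fun n : ℕ => 2 ^ n := by
  refine (Primrec.nat_rec₁ 1
    (Primrec.nat_mul.comp Primrec.snd (Primrec.const 2)).to₂).of_eq fun n => ?_
  induction n with
  | zero => rfl
  | succ n ih => simp only [pow_succ]; rw [← ih]

theorem primrec_boundE : Primrec₂ boundE := by
  refine (Primrec.nat_rec (Primrec.const 0) (g := fun n (p : ℕ × ℕ) => p.2 + n * 2 ^ p.2)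
    (Primrec.nat_add.comp (Primrec.snd.comp Primrec.snd)
      (Primrec.nat_mul.comp Primrec.fst
        (primrec_two_pow.comp (Primrec.snd.comp Primrec.snd)))).to₂).of_eq fun n k => ?_
  induction k with
  | zero => rfl
  | succ k ih => rw [boundE_succ, ← ih]

theorem primrec_boundQ : Primrec₂ boundQ := by
  refine (Primrec.nat_rec (Primrec.const 0) (g := fun n (p : ℕ × ℕ) => 1 + boundE n p.1 * p.2)
    (Primrec.nat_add.comp (Primrec.const 1)
      (Primrec.nat_mul.comp (primrec_boundE.comp Primrec.fst (Primrec.fst.comp Primrec.snd))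
        (Primrec.snd.comp Primrec.snd))).to₂).of_eq fun n k => ?_
  induction k with
  | zero => rfl
  | succ k ih => rw [boundQ_succ, ← ih]

theorem computable_modelBound : Computable modelBound := by
  have add (k : ℕ) : Primrec fun s : ℕ => s + k := Primrec.nat_add.comp .id (.const k)
  have p₁ := primrec_two_pow.comp (add 1)
  exact (Primrec.nat_mul.comp (primrec_boundQ.comp p₁ (add 3))
    (Primrec.nat_add.comp
      (Primrec.nat_mul.comp (.const 2) (primrec_boundE.comp primrec_two_pow (add 1)))
      (Primrec.nat_mul.comp
        (Primrec.nat_mul.comp .id (primrec_boundQ.comp primrec_two_pow (add 1)))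
        (primrec_boundE.comp p₁ (add 3))))).to_comp

/-! ### Finite-level types and their stabilisation. -/

/-- Iterated neighbourhood types of points labelled in `Λ`: a label, together with the set of types
of the previous level that occur above. -/
def LayerType (Λ : Type) : ℕ → Type
  | 0 => Λ
  | k + 1 => Λ × Set (LayerType Λ k)

namespace LayerType

instance instFinite (Λ : Type) [Finite Λ] : (k : ℕ) → Finite (LayerType Λ k)
  | 0 => inferInstanceAs (Finite Λ)
  | k + 1 => by
    have := instFinite Λ k
    exact inferInstanceAs (Finite (Λ × Set (LayerType Λ k)))

theorem card_le (Λ : Type) [Finite Λ] (k : ℕ) :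
    Nat.card (LayerType Λ k) ≤ boundE (Nat.card Λ) (k + 1) := by
  induction k with
  | zero => simp [boundE, LayerType]
  | succ k ih =>
    have h : Nat.card (LayerType Λ (k + 1)) = Nat.card Λ * 2 ^ Nat.card (LayerType Λ k) := by
      change Nat.card (Λ × Set (LayerType Λ k)) = _
      have := Fintype.ofFinite (LayerType Λ k)
      classical
      rw [Nat.card_prod, Nat.card_eq_fintype_card (α := Set _), Fintype.card_set,
        Nat.card_eq_fintype_card (α := LayerType Λ k)]
    rw [h, boundE_succ]
    exact (Nat.mul_le_mul_left _ (Nat.pow_le_pow_right two_pos ih)).trans (Nat.le_add_left _ _)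

/-- The label of a point of the given type. -/
def label {Λ : Type} : {k : ℕ} → LayerType Λ k → Λ
  | 0, t => t
  | _ + 1, t => t.1

variable {Λ : Type} {X : Type*} (r : X → X → Prop) (ℓ : X → Λ)

/-- The type of level `k` of a point `x` of a labelled frame. -/
def of : (k : ℕ) → X → LayerType Λ k
  | 0, x => ℓ x
  | k + 1, x => (ℓ x, {t | ∃ y, r x y ∧ ℓ y ≠ ℓ x ∧ of k y = t})

theorem label_of (k : ℕ) (x : X) : (of r ℓ k x).label = ℓ x := by
  cases k <;> rfl

theorem label_eq_of_of_eq {k : ℕ} {x x' : X} (h : of r ℓ k x = of r ℓ k x') : ℓ x = ℓ x' := by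
  rw [← label_of r ℓ k x, h, label_of]

variable {r ℓ}

theorem exists_of_of_succ_eq {k : ℕ} {x x' y : X} (h : of r ℓ (k + 1) x = of r ℓ (k + 1) x')
    (hxy : r x y) (hy : ℓ y ≠ ℓ x) : ∃ y', r x' y' ∧ ℓ y' ≠ ℓ x' ∧ of r ℓ k y' = of r ℓ k y := by
  have h₂ : of r ℓ k y ∈ {t | ∃ y, r x y ∧ ℓ y ≠ ℓ x ∧ of r ℓ k y = t} := ⟨y, hxy, hy, rfl⟩
  have h₃ := congrArg Prod.snd h
  simp only [of] at h₃
  rw [h₃] at h₂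
  exact h₂

/-- Types stabilise once their level reaches the rank of the label. -/
theorem of_succ_eq {rank : Λ → ℕ} (hrank : ∀ x y, r x y → ℓ y ≠ ℓ x → rank (ℓ y) < rank (ℓ x))
    {k : ℕ} : ∀ {x x' : X}, rank (ℓ x) ≤ k → of r ℓ k x = of r ℓ k x' →
      of r ℓ (k + 1) x = of r ℓ (k + 1) x' := by
  -- By symmetry one inclusion is enough. Equal types match `y` only one level down; since the rank
  -- of `y` has dropped, induction lifts that match by a level.
  suffices key : ∀ {x x' y : X}, rank (ℓ x) ≤ k → of r ℓ k x = of r ℓ k x' → r x y → ℓ y ≠ ℓ x →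
      ∃ y', r x' y' ∧ ℓ y' ≠ ℓ x' ∧ of r ℓ k y' = of r ℓ k y by
    intro x x' hx h
    have hℓ := label_eq_of_of_eq r ℓ h
    refine Prod.ext hℓ (Set.ext fun t => ⟨?_, ?_⟩)
    · rintro ⟨y, hxy, hy, rfl⟩
      exact key hx h hxy hy
    · rintro ⟨y, hxy, hy, rfl⟩
      exact key (hℓ ▸ hx) h.symm hxy hy
  induction k with
  | zero =>
    intro x x' y hx _ hxy hy
    exact absurd (hrank x y hxy hy) (by omega)
  | succ k ih =>
    intro x x' y hx h hxy hy
    obtain ⟨y', h₁, h₂, h₃⟩ := exists_of_of_succ_eq h hxy hy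
    refine ⟨y', h₁, h₂, ?_⟩
    have hy' : rank (ℓ y) ≤ k := by have := hrank x y hxy hy; omega
    have hℓ := label_eq_of_of_eq r ℓ h₃
    refine Prod.ext hℓ (Set.ext fun t => ⟨?_, ?_⟩)
    · rintro ⟨z, hz, hz', rfl⟩
      exact ih (hℓ ▸ hy') h₃ hz hz'
    · rintro ⟨z, hz, hz', rfl⟩
      exact ih hy' h₃.symm hz hz'

/-- Points of equal type, at a level bounding all ranks, see the same types above them. -/
theorem exists_of_of_eq {rank : Λ → ℕ}
    (hrank : ∀ x y, r x y → ℓ y ≠ ℓ x → rank (ℓ y) < rank (ℓ x))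
    {k : ℕ} {x x' y : X} (hk : rank (ℓ x) ≤ k) (h : of r ℓ k x = of r ℓ k x')
    (hxy : r x y) (hy : ℓ y ≠ ℓ x) : ∃ y', r x' y' ∧ of r ℓ k y' = of r ℓ k y :=
  let ⟨y', h₁, _, h₂⟩ := exists_of_of_succ_eq (of_succ_eq hrank hk h) hxy hy
  ⟨y', h₁, h₂⟩

end LayerType
-- Persistence of truth and settling of temporal formulas.
namespace Model

variable {P : Type u} (M : Model.{u, v} P)

theorem sat_mono {θ : Formula P} : ∀ {w v : M.World}, w ≤ v → M.Sat w θ → M.Sat v θ := by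
  have iter : ∀ (k : ℕ) {w v : M.World}, w ≤ v → M.succ^[k] w ≤ M.succ^[k] v := fun k w v h =>
    Monotone.iterate (fun a b => M.confluent a b) k h
  induction θ with
  | var p => intro w v h; exact fun hp => M.val_mono w v h hp
  | bot => intro w v h; exact id
  | and φ ψ h₁ h₂ => intro w v h; exact And.imp (h₁ h) (h₂ h)
  | or φ ψ h₁ h₂ => intro w v h; exact Or.imp (h₁ h) (h₂ h)
  | imp φ ψ h₁ h₂ => intro w v h hw z hz; exact hw z (h.trans hz)
  | next φ ih => intro w v h; exact ih (M.confluent w v h)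
  | eventually φ ih => intro w v h; exact fun ⟨k, hk⟩ => ⟨k, ih (iter k h) hk⟩
  | henceforth φ ih => intro w v h; exact fun hw k => ih (iter k h) (hw k)

/-- The event that settles the temporal formula `χ`: fulfilment of `◇ψ`, refutation of `□ψ`. -/
def Settles (χ : Formula P) (w : M.World) : Prop :=
  match χ with
  | .eventually ψ => M.Sat w ψ
  | .henceforth ψ => ¬ M.Sat w ψ
  | _ => False

/-- `χ` is settled in fewer than `K` steps from `w`. -/
def SettlesWithin (χ : Formula P) (K : ℕ) (w : M.World) : Prop :=
  ∃ j < K, M.Settles χ (M.succ^[j] w)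

/-- A monotone property of worlds equivalent to `SettlesWithin` or to its negation. -/
def DeadlineBit (χ : Formula P) (K : ℕ) (w : M.World) : Prop :=
  match χ with
  | .henceforth ψ => ¬ M.SettlesWithin (.henceforth ψ) K w
  | χ => M.SettlesWithin χ K w

variable {M}

theorem deadlineBit_mono {χ : Formula P} {K : ℕ} {w v : M.World} (h : w ≤ v)
    (hw : M.DeadlineBit χ K w) : M.DeadlineBit χ K v := by
  have iter (k : ℕ) : M.succ^[k] w ≤ M.succ^[k] v :=
    Monotone.iterate (fun a b => M.confluent a b) k h
  cases χ with
  | eventually ψ => exact let ⟨j, hj, hs⟩ := hw; ⟨j, hj, M.sat_mono (iter j) hs⟩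
  | henceforth ψ => exact fun ⟨j, hj, hs⟩ => hw ⟨j, hj, fun h' => hs (M.sat_mono (iter j) h')⟩
  | _ => exact let ⟨j, hj, hs⟩ := hw; ⟨j, hj, hs⟩

theorem settlesWithin_iff {χ : Formula P} {K K' : ℕ} {w w' : M.World}
    (h : M.DeadlineBit χ K w ↔ M.DeadlineBit χ K' w') :
    M.SettlesWithin χ K w ↔ M.SettlesWithin χ K' w' := by
  cases χ with
  | henceforth ψ => exact not_iff_not.1 h
  | _ => exact h

theorem settlesWithin_succ {χ : Formula P} {K : ℕ} {w : M.World} :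
    M.SettlesWithin χ (K + 1) w ↔ M.Settles χ w ∨ M.SettlesWithin χ K (M.succ w) := by
  constructor
  · rintro ⟨j, hj, hs⟩
    cases j with
    | zero => exact .inl hs
    | succ j => exact .inr ⟨j, by omega, hs⟩
  · rintro (hs | ⟨j, hj, hs⟩)
    · exact ⟨0, by omega, hs⟩
    · exact ⟨j + 1, by omega, hs⟩

theorem exists_settles_iff {χ : Formula P} {w : M.World} :
    (∃ j, M.Settles χ (M.succ^[j] w)) ↔
      M.Settles χ w ∨ ∃ j, M.Settles χ (M.succ^[j] (M.succ w)) := by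
  constructor
  · rintro ⟨j, hs⟩
    cases j with
    | zero => exact .inl hs
    | succ j => exact .inr ⟨j, hs⟩
  · rintro (hs | ⟨j, hs⟩)
    · exact ⟨0, hs⟩
    · exact ⟨j + 1, hs⟩

/-- Agreement of two worlds on a set of formulas. -/
def Agree (Γ : Set (Formula P)) (w w' : M.World) : Prop :=
  ∀ θ ∈ Γ, M.Sat w θ ↔ M.Sat w' θ

end Model

/-- A set of formulas is closed when it contains the immediate subformulas of its members. -/
structure Formula.Closed {P : Type u} (Γ : Set (Formula P)) : Prop where
  and : ∀ {φ ψ}, Formula.and φ ψ ∈ Γ → φ ∈ Γ ∧ ψ ∈ Γ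
  or : ∀ {φ ψ}, Formula.or φ ψ ∈ Γ → φ ∈ Γ ∧ ψ ∈ Γ
  imp : ∀ {φ ψ}, Formula.imp φ ψ ∈ Γ → φ ∈ Γ ∧ ψ ∈ Γ
  next : ∀ {φ}, Formula.next φ ∈ Γ → φ ∈ Γ
  eventually : ∀ {φ}, Formula.eventually φ ∈ Γ → φ ∈ Γ
  henceforth : ∀ {φ}, Formula.henceforth φ ∈ Γ → φ ∈ Γ

theorem Formula.mem_sub_self {P : Type u} (φ : Formula P) : φ ∈ φ.sub := by
  cases φ <;> simp [Formula.sub]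

theorem Formula.sub_subset {P : Type u} {φ θ : Formula P} (h : θ ∈ φ.sub) : θ.sub ⊆ φ.sub := by
  induction φ with
  | var p => rw [Set.mem_singleton_iff.1 h]
  | bot => rw [Set.mem_singleton_iff.1 h]
  | and φ ψ h₁ h₂ | or φ ψ h₁ h₂ | imp φ ψ h₁ h₂ =>
    rcases h with h | h | h
    · rw [Set.mem_singleton_iff.1 h]
    · exact (h₁ h).trans (Set.subset_union_left.trans Set.subset_union_right)
    · exact (h₂ h).trans (Set.subset_union_right.trans Set.subset_union_right)
  | next φ ih | eventually φ ih | henceforth φ ih =>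
    rcases h with h | h
    · rw [Set.mem_singleton_iff.1 h]
    · exact (ih h).trans Set.subset_union_right

theorem Formula.closed_sub {P : Type u} (φ : Formula P) : Formula.Closed φ.sub where
  and h := ⟨sub_subset h (.inr (.inl (mem_sub_self _))), sub_subset h (.inr (.inr (mem_sub_self _)))⟩
  or h := ⟨sub_subset h (.inr (.inl (mem_sub_self _))), sub_subset h (.inr (.inr (mem_sub_self _)))⟩
  imp h := ⟨sub_subset h (.inr (.inl (mem_sub_self _))), sub_subset h (.inr (.inr (mem_sub_self _)))⟩
  next h := sub_subset h (.inr (mem_sub_self _))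
  eventually h := sub_subset h (.inr (mem_sub_self _))
  henceforth h := sub_subset h (.inr (mem_sub_self _))

namespace Model

variable {P : Type u} {M : Model.{u, v} P} {Γ : Set (Formula P)}

/-- Being settled at some time is the truth of `◇ψ` or the failure of `□ψ`, so agreement on `χ`
itself decides it. -/
theorem Agree.exists_settles_iff {χ : Formula P} (hχ : χ ∈ Γ) {w w' : M.World}
    (h : Agree Γ w w') :
    (∃ j, M.Settles χ (M.succ^[j] w)) ↔ ∃ j, M.Settles χ (M.succ^[j] w') := by
  cases χ with
  | eventually ψ => exact h _ hχ
  | henceforth ψ => exact not_forall.symm.trans ((not_congr (h _ hχ)).trans not_forall)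
  | _ => exact ⟨fun ⟨_, h⟩ => h.elim, fun ⟨_, h⟩ => h.elim⟩

end Model

/-! ### The layered quotient of a model -/

namespace Layered

open Model

variable {P : Type u} (M : Model.{u, v} P) {m : ℕ} (e : Fin (m + 1) → Formula P)

/-- Labels record which of the formulas listed by `e` hold, and one further bit. -/
abbrev Label (m : ℕ) : Type := Set (Option (Fin (m + 1)))

/-- The types used to build layers; the level bounds the length of chains of labels. -/
abbrev Ty (m : ℕ) : Type := LayerType (Label m) (m + 2)

/-- A world seen while the formula `e c` is being tracked with deadline `K`. -/
abbrev Tracked (m : ℕ) : Type v := Fin (m + 1) × ℕ × M.World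

variable {M} in
/-- The order of worlds, tracked in the same way. -/
def Le (x y : Tracked M m) : Prop := x.1 = y.1 ∧ x.2.1 = y.2.1 ∧ x.2.2 ≤ y.2.2

variable {M} in
/-- The label of a tracked world. -/
def lab (x : Tracked M m) : Label m :=
  {o | match o with
    | some i => M.Sat x.2.2 (e i)
    | none => M.DeadlineBit (e x.1) x.2.1 x.2.2}

variable {M} in
/-- The type of a tracked world. -/
def ty (x : Tracked M m) : Ty m := LayerType.of Le (lab e) (m + 2) x

variable {M e}

theorem label_ty (x : Tracked M m) : (ty e x).label = lab e x := LayerType.label_of _ _ _ _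

theorem lab_mono {x y : Tracked M m} (h : Le x y) : lab e x ⊆ lab e y := by
  obtain ⟨c, K, w⟩ := x
  obtain ⟨_, _, v⟩ := y
  obtain ⟨rfl, rfl, h⟩ := h
  rintro (_ | i) hx
  · exact deadlineBit_mono h hx
  · exact M.sat_mono h hx

theorem exists_ty_eq {x x' y : Tracked M m} (h : ty e x = ty e x') (hxy : Le x y)
    (hy : lab e y ≠ lab e x) : ∃ y', Le x' y' ∧ ty e y' = ty e y := by
  -- Labels only grow, so their complements shrink; these have at most `m + 2` elements, which is
  -- the level of `Ty m`.
  refine LayerType.exists_of_of_eq (rank := fun A => Aᶜ.ncard) (fun x y hxy hy => ?_) ?_ h hxy hy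
  · exact Set.ncard_lt_ncard (compl_lt_compl_iff_lt.2 ((lab_mono hxy).ssubset_of_ne hy.symm))
  · refine (Set.ncard_le_card _).trans ?_
    simp

theorem agree_of_lab_eq {x y : Tracked M m} (h : lab e x = lab e y) :
    Agree (Set.range e) x.2.2 y.2.2 := by
  rintro _ ⟨i, rfl⟩
  exact Iff.of_eq (congrArg (some i ∈ ·) h)

theorem settlesWithin_of_lab_eq {c : Fin (m + 1)} {K K' : ℕ} {w w' : M.World}
    (h : lab e (c, K, w) = lab e (c, K', w')) :
    M.SettlesWithin (e c) K w ↔ M.SettlesWithin (e c) K' w' :=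
  settlesWithin_iff (Iff.of_eq (congrArg (none ∈ ·) h))

/-! ### Paths of types and their realisation. -/

variable (M e)

/-- Type `b` occurs above type `a`, with a different label. -/
def Cover (a b : Ty m) : Prop :=
  ∃ x y : Tracked M m, Le x y ∧ lab e y ≠ lab e x ∧ ty e x = a ∧ ty e y = b

/-- The last type on a path, which is listed from its end to its start, the root `t` excluded. -/
abbrev top (t : Ty m) (x : List (Ty m)) : Ty m := x.headD t

/-- Paths of types starting at the root `t`. -/
def IsPath (t : Ty m) : List (Ty m) → Prop
  | [] => True
  | b :: x => Cover M e (top t x) b ∧ IsPath t x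

/-- Type `t` occurs while `e c` is being tracked. -/
def Occurs (c : Fin (m + 1)) (t : Ty m) : Prop := ∃ K w, ty e (M := M) (c, K, w) = t

variable {M e}

theorem Cover.label_ssubset {a b : Ty m} (h : Cover M e a b) : a.label ⊂ b.label := by
  obtain ⟨x, y, hxy, hne, rfl, rfl⟩ := h
  rw [label_ty, label_ty]
  exact (lab_mono hxy).ssubset_of_ne hne.symm

theorem IsPath.pairwise {t : Ty m} {x : List (Ty m)} (h : IsPath M e t x) :
    (x ++ [t]).Pairwise fun b a => a.label ⊂ b.label := by
  induction x with
  | nil => simp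
  | cons b x ih =>
    have hx := ih h.2
    have hb := h.1.label_ssubset
    refine List.pairwise_cons.2 ⟨fun a ha => ?_, hx⟩
    cases x with
    | nil => simp_all
    | cons d x =>
      rcases List.mem_cons.1 ha with rfl | ha
      · exact hb
      · exact ((List.pairwise_cons.1 hx).1 a ha).trans hb

/-- Labels increase strictly along a path, so its entries are distinct and their order is forced. -/
theorem IsPath.eq_of_toSet_eq {t : Ty m} {x y : List (Ty m)} (hx : IsPath M e t x)
    (hy : IsPath M e t y) (h : {a | a ∈ x} = {a | a ∈ y}) : x = y := by
  have px := (List.pairwise_append.1 hx.pairwise).1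
  have py := (List.pairwise_append.1 hy.pairwise).1
  have nx : x.Nodup := px.imp fun h => by rintro rfl; exact ssubset_irrefl _ h
  have ny : y.Nodup := py.imp fun h => by rintro rfl; exact ssubset_irrefl _ h
  refine List.Perm.eq_of_pairwise (fun a b _ _ h₁ h₂ => (ssubset_asymm h₁ h₂).elim) px py ?_
  exact (List.perm_ext_iff_of_nodup nx ny).2 fun a => Set.ext_iff.1 h a

theorem finite_setOf_isPath (t : Ty m) : {x | IsPath M e t x}.Finite :=
  Set.Finite.of_injOn (f := fun x => {a | a ∈ x}) (t := Set.univ) (fun _ _ => trivial)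
    (fun _ hx _ hy h => hx.eq_of_toSet_eq hy h) Set.finite_univ

variable (M e)

/-- The least deadline for which a type occurs. -/
noncomputable def deadline (c : Fin (m + 1)) (t : Ty m) : ℕ :=
  sInf {K | ∃ w, ty e (M := M) (c, K, w) = t}

/-- A path of types realised in the model, each world above the previous one. -/
noncomputable def realize (c : Fin (m + 1)) (t : Ty m) : List (Ty m) → M.World
  | [] => @Classical.epsilon _ M.nonempty fun w => ty e (c, deadline M e c t, w) = t
  | b :: x => @Classical.epsilon _ M.nonempty fun v =>
      realize c t x ≤ v ∧ ty e (c, deadline M e c t, v) = b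

variable {M e}

theorem deadline_le {c : Fin (m + 1)} {K : ℕ} {w : M.World} {t : Ty m} (h : ty e (c, K, w) = t) :
    deadline M e c t ≤ K := Nat.sInf_le ⟨w, h⟩

/-- The choices in `realize` succeed: `Cover` holds for some pair of tracked worlds, and
`exists_ty_eq` moves it above the world already chosen, at the same deadline. -/
theorem ty_realize {c : Fin (m + 1)} {t : Ty m} (ht : Occurs M e c t) {x : List (Ty m)}
    (hx : IsPath M e t x) : ty e (c, deadline M e c t, realize M e c t x) = top t x ∧
      ∀ b y, x = b :: y → realize M e c t y ≤ realize M e c t x := by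
  induction x with
  | nil =>
    refine ⟨?_, by simp⟩
    exact @Classical.epsilon_spec _ (fun w => ty e (c, deadline M e c t, w) = t)
      (Nat.sInf_mem (s := {K | ∃ w, ty e (M := M) (c, K, w) = t}) ht)
  | cons b x ih =>
    obtain ⟨x₀, y₀, hxy, hne, hx₀, hy₀⟩ := hx.1
    obtain ⟨⟨_, _, v⟩, ⟨rfl, rfl, hv⟩, hty⟩ :=
      exists_ty_eq (hx₀.trans (ih hx.2).1.symm) hxy hne
    have := @Classical.epsilon_spec _ (fun v => realize M e c t x ≤ v ∧
      ty e (c, deadline M e c t, v) = b) ⟨v, hv, hty.trans hy₀⟩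
    refine ⟨this.2, ?_⟩
    rintro _ _ ⟨⟩
    exact this.1

theorem realize_mono {c : Fin (m + 1)} {t : Ty m} (ht : Occurs M e c t) {x y : List (Ty m)}
    (hy : IsPath M e t y) (h : x <:+ y) : realize M e c t x ≤ realize M e c t y := by
  induction y with
  | nil => rw [List.suffix_nil.1 h]
  | cons b y ih =>
    rcases List.suffix_cons_iff.1 h with rfl | h
    · exact le_rfl
    · exact (ih hy.2 h).trans ((ty_realize ht hy).2 b y rfl)

theorem lab_realize {c : Fin (m + 1)} {t : Ty m} (ht : Occurs M e c t) {x : List (Ty m)}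
    (hx : IsPath M e t x) :
    lab e (c, deadline M e c t, realize M e c t x) = (top t x).label := by
  rw [← (ty_realize ht hx).1, label_ty]

/-! ### Reading a path of types off a monotone family of worlds. -/

section Transfer

variable (e) (c : Fin (m + 1)) (K : ℕ) (G : List (Ty m) → M.World)

open Classical in
/-- The path of types of the worlds `G` assigns to the initial segments of a path, with
repetitions of labels removed. -/
noncomputable def transfer : List (Ty m) → List (Ty m)
  | [] => []
  | b :: x =>
      if lab e (c, K, G (b :: x)) = (top (ty e (c, K, G [])) (transfer x)).label then transfer x
      else ty e (c, K, G (b :: x)) :: transfer x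

theorem transfer_mono {x y : List (Ty m)} (h : x <:+ y) :
    transfer e c K G x <:+ transfer e c K G y := by
  induction y with
  | nil => rw [List.suffix_nil.1 h]
  | cons b y ih =>
    rcases List.suffix_cons_iff.1 h with rfl | h
    · exact List.suffix_rfl
    · refine (ih h).trans ?_
      rw [transfer]
      split_ifs
      · exact List.suffix_rfl
      · exact List.suffix_cons _ _

variable {e c K G}

/-- When a label repeats, the last type may differ from the type of `G x`. The third clause keeps a
world below `G x` that has this last type, as the next `Cover` step needs. -/
theorem transfer_spec {t : Ty m} {x : List (Ty m)} (hx : IsPath M e t x)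
    (hG : ∀ b y, IsPath M e t (b :: y) → G y ≤ G (b :: y)) :
    IsPath M e (ty e (c, K, G [])) (transfer e c K G x) ∧
      lab e (c, K, G x) = (top (ty e (c, K, G [])) (transfer e c K G x)).label ∧
      ∃ w ≤ G x, ty e (c, K, w) = top (ty e (c, K, G [])) (transfer e c K G x) := by
  induction x with
  | nil => exact ⟨trivial, (label_ty _).symm, _, le_rfl, rfl⟩
  | cons b x ih =>
    obtain ⟨h₁, h₂, w, hw, hty⟩ := ih hx.2
    have hle := hG b x hx
    rw [transfer]
    split_ifs with h
    · exact ⟨h₁, h, w, hw.trans hle, hty⟩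
    · refine ⟨⟨⟨(c, K, w), (c, K, G (b :: x)), ⟨rfl, rfl, hw.trans hle⟩, ?_, hty, rfl⟩, h₁⟩,
        (label_ty _).symm, _, le_rfl, rfl⟩
      rwa [← label_ty (c, K, w), hty]

end Transfer

/-! ### Worlds and dynamics of the quotient. -/

variable (M e)

/-- The worlds of the layered quotient: the tracked formula, the root of the layer and the
path. -/
def World : Type :=
  {ω : Fin (m + 1) × Ty m × List (Ty m) // Occurs M e ω.1 ω.2.1 ∧ IsPath M e ω.2.1 ω.2.2}

/-- Worlds are ordered by extension of paths within a layer. -/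
instance : PartialOrder (World M e) where
  le ω ω' := ω.1.1 = ω'.1.1 ∧ ω.1.2.1 = ω'.1.2.1 ∧ ω.1.2.2 <:+ ω'.1.2.2
  le_refl ω := ⟨rfl, rfl, List.suffix_rfl⟩
  le_trans ω₁ ω₂ ω₃ h h' := ⟨h.1.trans h'.1, h.2.1.trans h'.2.1, h.2.2.trans h'.2.2⟩
  le_antisymm ω₁ ω₂ h h' := Subtype.ext (Prod.ext h.1 (Prod.ext h.2.1
    (h.2.2.eq_of_length_le h'.2.2.length_le)))

/-- The formula tracked in the layer following a given one. -/
noncomputable def nextPhase (c : Fin (m + 1)) (t : Ty m) : Fin (m + 1) :=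
  if deadline M e c t = 0 then c + 1 else c

/-- The deadline in the layer following a given one. A fresh one is long enough to settle the new
formula wherever this will ever happen. -/
noncomputable def nextDeadline (c : Fin (m + 1)) (t : Ty m) : ℕ :=
  if deadline M e c t = 0 then
    Classical.epsilon fun K => ∀ x, IsPath M e t x →
      (∃ j, M.Settles (e (c + 1)) (M.succ^[j] (M.succ (realize M e c t x)))) →
        M.SettlesWithin (e (c + 1)) K (M.succ (realize M e c t x))
  else deadline M e c t - 1

/-- Images of the realised paths of a layer under the dynamics. -/
noncomputable abbrev image (c : Fin (m + 1)) (t : Ty m) (x : List (Ty m)) : M.World :=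
  M.succ (realize M e c t x)

variable {M e}

theorem settlesWithin_nextDeadline {c : Fin (m + 1)} {t : Ty m} (h : deadline M e c t = 0)
    {x : List (Ty m)} (hx : IsPath M e t x)
    (hs : ∃ j, M.Settles (e (c + 1)) (M.succ^[j] (image M e c t x))) :
    M.SettlesWithin (e (c + 1)) (nextDeadline M e c t) (image M e c t x) := by
  rw [nextDeadline, if_pos h]
  refine Classical.epsilon_spec (p := fun K => ∀ x, IsPath M e t x →
      (∃ j, M.Settles (e (c + 1)) (M.succ^[j] (M.succ (realize M e c t x)))) →
        M.SettlesWithin (e (c + 1)) K (M.succ (realize M e c t x))) ?_ x hx hs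
  have key : ∀ x : List (Ty m), ∃ K,
      (∃ j, M.Settles (e (c + 1)) (M.succ^[j] (M.succ (realize M e c t x)))) →
        M.SettlesWithin (e (c + 1)) K (M.succ (realize M e c t x)) := fun x => by
    by_cases hj : ∃ j, M.Settles (e (c + 1)) (M.succ^[j] (M.succ (realize M e c t x)))
    · obtain ⟨j, hj⟩ := hj
      exact ⟨j + 1, fun _ => ⟨j, j.lt_succ_self, hj⟩⟩
    · exact ⟨0, fun h => (hj h).elim⟩
  choose k hk using key
  -- Finitely many paths leave the root, so one deadline serves them all.
  obtain ⟨K, hK⟩ := ((finite_setOf_isPath (M := M) (e := e) t).image k).bddAbove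
  refine ⟨K, fun x hx hs => ?_⟩
  obtain ⟨j, hj, h⟩ := hk x hs
  exact ⟨j, hj.trans_le (hK ⟨x, hx, rfl⟩), h⟩

theorem image_le {c : Fin (m + 1)} {t : Ty m} (ht : Occurs M e c t) (b : Ty m) (y : List (Ty m))
    (h : IsPath M e t (b :: y)) : image M e c t y ≤ image M e c t (b :: y) :=
  M.confluent _ _ (realize_mono ht h (List.suffix_cons b y))

/-- The dynamics of the layered quotient. -/
noncomputable def next (ω : World M e) : World M e :=
  ⟨(nextPhase M e ω.1.1 ω.1.2.1,
    ty e (nextPhase M e ω.1.1 ω.1.2.1, nextDeadline M e ω.1.1 ω.1.2.1, image M e ω.1.1 ω.1.2.1 []),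
    transfer e (nextPhase M e ω.1.1 ω.1.2.1) (nextDeadline M e ω.1.1 ω.1.2.1)
      (image M e ω.1.1 ω.1.2.1) ω.1.2.2),
    ⟨_, _, rfl⟩, (transfer_spec ω.2.2 (image_le ω.2.1)).1⟩

/-- The world of the original model represented by a world of the layered quotient. -/
noncomputable def toWorld (ω : World M e) : M.World := realize M e ω.1.1 ω.1.2.1 ω.1.2.2

/-- The number of steps left before the tracked formula changes. -/
noncomputable def remaining (ω : World M e) : ℕ := deadline M e ω.1.1 ω.1.2.1

theorem toWorld_mono {ω ω' : World M e} (h : ω ≤ ω') : toWorld ω ≤ toWorld ω' := by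
  obtain ⟨⟨c, t, x⟩, hω⟩ := ω
  obtain ⟨⟨_, _, y⟩, hω'⟩ := ω'
  obtain ⟨h₁, h₂, h⟩ := h
  dsimp only at h₁ h₂ h
  subst h₁ h₂
  exact realize_mono hω.1 hω'.2 h

theorem next_mono {ω ω' : World M e} (h : ω ≤ ω') : next ω ≤ next ω' := by
  obtain ⟨⟨c, t, x⟩, hω⟩ := ω
  obtain ⟨⟨_, _, y⟩, hω'⟩ := ω'
  obtain ⟨h₁, h₂, h⟩ := h
  dsimp only at h₁ h₂ h
  subst h₁ h₂
  exact ⟨rfl, rfl, transfer_mono _ _ _ _ h⟩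

/-- The two worlds may differ, and so may the deadlines, since a layer is realised at its own least
deadline; `transfer` and `realize` preserve only the label. -/
theorem lab_next (ω : World M e) :
    lab e ((next ω).1.1, remaining (next ω), toWorld (next ω)) =
      lab e ((next ω).1.1, nextDeadline M e ω.1.1 ω.1.2.1, M.succ (toWorld ω)) :=
  (lab_realize (next ω).2.1 (next ω).2.2).trans
    (transfer_spec ω.2.2 (image_le ω.2.1)).2.1.symm

theorem agree_next (ω : World M e) :
    Agree (Set.range e) (toWorld (next ω)) (M.succ (toWorld ω)) :=
  agree_of_lab_eq (lab_next ω)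

theorem remaining_next_le (ω : World M e) :
    remaining (next ω) ≤ nextDeadline M e ω.1.1 ω.1.2.1 :=
  deadline_le rfl

/-! ### Settling of temporal formulas along orbits of the quotient. -/

theorem settlesWithin_next (ω : World M e) :
    M.SettlesWithin (e (next ω).1.1) (remaining (next ω)) (toWorld (next ω)) ↔
      M.SettlesWithin (e (next ω).1.1) (nextDeadline M e ω.1.1 ω.1.2.1) (M.succ (toWorld ω)) :=
  settlesWithin_of_lab_eq (lab_next ω)

theorem exists_settles_of_settlesWithin {k : ℕ} : ∀ {ω : World M e}, remaining ω ≤ k →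
    M.SettlesWithin (e ω.1.1) (remaining ω) (toWorld ω) →
      ∃ n, M.Settles (e ω.1.1) (toWorld (next^[n] ω)) := by
  induction k with
  | zero =>
    -- Nothing is settled in fewer than `0` steps, so a true bit cannot survive to the end of the
    -- countdown.
    rintro ω hk ⟨j, hj, _⟩
    omega
  | succ k ih =>
    intro ω hk hs
    by_cases h0 : remaining ω = 0
    · exact ih (by omega) hs
    · obtain ⟨r, hr⟩ := Nat.exists_eq_succ_of_ne_zero h0
      have hd : deadline M e ω.1.1 ω.1.2.1 = r + 1 := hr
      have hphase : (next ω).1.1 = ω.1.1 := if_neg h0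
      have hnd : nextDeadline M e ω.1.1 ω.1.2.1 = r :=
        (if_neg h0 : _ = deadline M e ω.1.1 ω.1.2.1 - 1).trans (congrArg (· - 1) hd)
      rw [hr, Nat.succ_eq_add_one, settlesWithin_succ] at hs
      rcases hs with hs | hs
      · exact ⟨0, hs⟩
      · have h₁ := settlesWithin_next ω
        rw [hnd, hphase] at h₁
        have h₂ := remaining_next_le ω
        have h₃ := ih (ω := next ω) (by omega)
        rw [hphase] at h₃
        obtain ⟨n, hn⟩ := h₃ (h₁.2 hs)
        exact ⟨n + 1, hn⟩

theorem exists_remaining_eq_zero {k : ℕ} : ∀ {ω : World M e}, remaining ω ≤ k →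
    ∃ n, (next^[n] ω).1.1 = ω.1.1 ∧ remaining (next^[n] ω) = 0 := by
  induction k with
  | zero => exact fun {ω} h => ⟨0, rfl, Nat.le_zero.1 h⟩
  | succ k ih =>
    intro ω hk
    by_cases h0 : remaining ω = 0
    · exact ⟨0, rfl, h0⟩
    · have hphase : (next ω).1.1 = ω.1.1 := if_neg h0
      have hnd : nextDeadline M e ω.1.1 ω.1.2.1 = remaining ω - 1 := if_neg h0
      have := remaining_next_le ω
      obtain ⟨n, h₁, h₂⟩ := ih (ω := next ω) (by omega)
      exact ⟨n + 1, h₁.trans hphase, h₂⟩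

/-- Every formula is eventually about to be tracked. -/
theorem exists_phase_eq (ω : World M e) (d : Fin (m + 1)) :
    ∃ n, (next^[n] ω).1.1 = ω.1.1 + d ∧ remaining (next^[n] ω) = 0 := by
  induction d using Fin.induction with
  | zero =>
    obtain ⟨n, h₁, h₂⟩ := exists_remaining_eq_zero (le_refl (remaining ω))
    exact ⟨n, by simpa using h₁, h₂⟩
  | succ i ih =>
    obtain ⟨n, h₁, h₂⟩ := ih
    have hphase : (next (next^[n] ω)).1.1 = (next^[n] ω).1.1 + 1 := if_pos h₂
    obtain ⟨k, h₃, h₄⟩ := exists_remaining_eq_zero (le_refl (remaining (next (next^[n] ω))))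
    rw [← Function.iterate_succ_apply' next, ← Function.iterate_add_apply] at h₃ h₄
    refine ⟨_, h₃.trans ?_, h₄⟩
    rw [Function.iterate_succ_apply', hphase, h₁, add_assoc, Fin.coeSucc_eq_succ]

theorem exists_settles_toWorld_iff (ω : World M e)
    (d : Fin (m + 1)) :
    (∃ n, M.Settles (e d) (toWorld (next^[n] ω))) ↔
      ∃ j, M.Settles (e d) (M.succ^[j] (toWorld ω)) := by
  have hd : e d ∈ Set.range e := ⟨d, rfl⟩
  constructor
  · rintro ⟨n, hn⟩
    induction n generalizing ω with
    | zero => exact ⟨0, hn⟩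
    | succ n ih =>
      exact exists_settles_iff.2 (.inr (((agree_next ω).exists_settles_iff hd).1 (ih (next ω) hn)))
  · intro hj
    by_contra! hcon
    -- While the formula stays unsettled on the orbit, its future settling passes from each
    -- representative to the next by agreement.
    have persist : ∀ n, ∃ j, M.Settles (e d) (M.succ^[j] (M.succ (toWorld (next^[n] ω)))) := by
      intro n
      refine (exists_settles_iff.1 ?_).resolve_left (hcon n)
      induction n with
      | zero => exact hj
      | succ n ih =>
        rw [Function.iterate_succ_apply', (agree_next _).exists_settles_iff hd]
        exact (exists_settles_iff.1 ih).resolve_left (hcon n)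
    -- The offset leads to the end of phase `d - 1`, so that the next step sets a fresh deadline for
    -- `e d`.
    obtain ⟨n, hn, hr⟩ := exists_phase_eq ω (d - 1 - ω.1.1)
    have hphase : (next (next^[n] ω)).1.1 = d := by
      refine (if_pos hr : _ = (next^[n] ω).1.1 + 1).trans ?_
      rw [hn]
      abel
    have hp : (next^[n] ω).1.1 + 1 = d := (if_pos hr : _ = (next^[n] ω).1.1 + 1).symm.trans hphase
    have h₁ := settlesWithin_nextDeadline hr (next^[n] ω).2.2 (by rw [hp]; exact persist n)
    have h₂ := settlesWithin_next (next^[n] ω)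
    rw [hp] at h₁
    rw [hphase] at h₂
    have h₃ := exists_settles_of_settlesWithin (le_refl (remaining (next (next^[n] ω))))
    rw [hphase] at h₃
    obtain ⟨k, hk⟩ := h₃ (h₂.2 h₁)
    refine hcon (k + n.succ) ?_
    rw [Function.iterate_add_apply, Function.iterate_succ_apply']
    exact hk

/-! ### The truth lemma and the size of the quotient. -/

variable (M e)

/-- The world of the layered quotient representing a given world. -/
noncomputable def ofWorld (w : M.World) : World M e :=
  ⟨(0, ty e (0, 0, w), []), ⟨0, w, rfl⟩, trivial⟩

/-- The layered quotient of a model. -/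
noncomputable def model : Model.{u, 0} P where
  World := World M e
  nonempty := M.nonempty.map (ofWorld M e)
  order := inferInstance
  succ := next
  confluent _ _ h := next_mono h
  val ω := M.val (toWorld ω)
  val_mono _ _ h := M.val_mono _ _ (toWorld_mono h)

variable {M e}

theorem sat_iff (he : Formula.Closed (Set.range e)) {θ : Formula P} (hθ : θ ∈ Set.range e) :
    ∀ ω : World M e, (model M e).Sat ω θ ↔ M.Sat (toWorld ω) θ := by
  induction θ with
  | var p => exact fun ω => Iff.rfl
  | bot => exact fun ω => Iff.rfl
  | and φ ψ h₁ h₂ => exact fun ω => and_congr (h₁ (he.and hθ).1 ω) (h₂ (he.and hθ).2 ω)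
  | or φ ψ h₁ h₂ => exact fun ω => or_congr (h₁ (he.or hθ).1 ω) (h₂ (he.or hθ).2 ω)
  | imp φ ψ h₁ h₂ =>
    intro ω
    have h₁ := h₁ (he.imp hθ).1
    have h₂ := h₂ (he.imp hθ).2
    constructor
    · intro h v hv hφ
      let x : Tracked M m := (ω.1.1, remaining ω, toWorld ω)
      let y : Tracked M m := (ω.1.1, remaining ω, v)
      -- If `v` has the label of `ω`, then `ω` itself stands in for `v`; otherwise the path extended
      -- by the type of `v` does, its realisation having the label of `v`.
      by_cases hlab : lab e y = lab e x
      · have hag := agree_of_lab_eq hlab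
        exact (hag _ (he.imp hθ).2).2 ((h₂ ω).1 (h ω le_rfl
          ((h₁ ω).2 ((hag _ (he.imp hθ).1).1 hφ))))
      · have hpath : IsPath M e ω.1.2.1 (ty e y :: ω.1.2.2) :=
          ⟨⟨x, y, ⟨rfl, rfl, hv⟩, hlab, (ty_realize ω.2.1 ω.2.2).1, rfl⟩, ω.2.2⟩
        let ω' : World M e := ⟨(ω.1.1, ω.1.2.1, ty e y :: ω.1.2.2), ω.2.1, hpath⟩
        have hle : ω ≤ ω' := ⟨rfl, rfl, List.suffix_cons _ _⟩
        have hl : lab e (ω.1.1, remaining ω, toWorld ω') = lab e y :=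
          (lab_realize ω.2.1 hpath).trans (label_ty y)
        have hag := agree_of_lab_eq hl
        exact (hag _ (he.imp hθ).2).1 ((h₂ ω').1 (h ω' hle
          ((h₁ ω').2 ((hag _ (he.imp hθ).1).2 hφ))))
    · intro h ω' hle hφ
      exact (h₂ ω').2 (h _ (toWorld_mono hle) ((h₁ ω').1 hφ))
  | next φ ih =>
    exact fun ω => (ih (he.next hθ) (next ω)).trans (agree_next ω _ (he.next hθ))
  | eventually φ ih =>
    obtain ⟨d, hd⟩ := hθ
    intro ω
    have := exists_settles_toWorld_iff ω d
    rw [hd] at this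
    exact (exists_congr fun n => ih (he.eventually ⟨d, hd⟩) (next^[n] ω)).trans this
  | henceforth φ ih =>
    obtain ⟨d, hd⟩ := hθ
    intro ω
    have := exists_settles_toWorld_iff ω d
    rw [hd] at this
    refine (forall_congr' fun n => ih (he.henceforth ⟨d, hd⟩) (next^[n] ω)).trans ?_
    have h := not_congr this
    simp only [Settles, not_exists, not_not] at h
    exact h

/-- The chosen representative need not be `w`; it only shares its type, hence its label. -/
theorem agree_toWorld_ofWorld (w : M.World) :
    Agree (Set.range e) (toWorld (ofWorld M e w)) w :=
  agree_of_lab_eq (x := (0, remaining (ofWorld M e w), toWorld (ofWorld M e w))) (y := (0, 0, w))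
    ((lab_realize (ofWorld M e w).2.1 (ofWorld M e w).2.2).trans (label_ty _))

variable (M e)

theorem sizeAtMost_model : (model M e).SizeAtMost (modelBound (m + 1)) := by
  let f : World M e → Fin (m + 1) × Ty m × Set (Ty m) :=
    fun ω => (ω.1.1, ω.1.2.1, {a | a ∈ ω.1.2.2})
  have hf : Function.Injective f := by
    rintro ⟨⟨c, t, x⟩, h⟩ ⟨⟨c', t', y⟩, h'⟩ heq
    simp only [f, Prod.mk.injEq] at heq
    obtain ⟨rfl, rfl, heq⟩ := heq
    have := h.2.eq_of_toSet_eq h'.2 heq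
    dsimp only at this
    subst this
    rfl
  refine ⟨Finite.of_injective f hf, (Nat.card_le_card_of_injective f hf).trans ?_⟩
  have hT : Nat.card (Ty m) ≤ boundE (2 ^ (m + 2)) (m + 3) := by
    have := LayerType.card_le (Label m) (m + 2)
    rwa [Nat.card_eq_fintype_card (α := Label m), Fintype.card_set, Fintype.card_option,
      Fintype.card_fin] at this
  have hS : Nat.card (Set (Ty m)) = 2 ^ Nat.card (Ty m) := by
    have := Fintype.ofFinite (Ty m)
    classical
    rw [Nat.card_eq_fintype_card, Fintype.card_set, Nat.card_eq_fintype_card]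
  rw [Nat.card_prod, Nat.card_prod, hS, Nat.card_eq_fintype_card, Fintype.card_fin]
  exact (Nat.mul_le_mul_left _ (Nat.mul_le_mul hT (Nat.pow_le_pow_right two_pos hT))).trans
    (mul_two_pow_le_modelBound (m + 1))

end Layered

/-- The truth of the subformulas of `φ` at any world is reflected in a model of bounded size. -/
theorem exists_sizeAtMost_sat_iff {P : Type u} (φ : Formula P) (M : Model.{u, v} P) (w : M.World) :
    ∃ (N : Model.{u, 0} P) (ω : N.World), N.SizeAtMost (modelBound φ.numSub) ∧
      (N.Sat ω φ ↔ M.Sat w φ) := by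
  have : Finite φ.sub := φ.sub_finite
  have : Nonempty φ.sub := ⟨⟨φ, φ.mem_sub_self⟩⟩
  obtain ⟨m, hm⟩ := Nat.exists_eq_succ_of_ne_zero (Nat.card_pos (α := φ.sub)).ne'
  let eqv : φ.sub ≃ Fin (m + 1) := Finite.equivFinOfCardEq hm
  let e : Fin (m + 1) → Formula P := fun i => (eqv.symm i).1
  have hrange : Set.range e = φ.sub :=
    (eqv.symm.surjective.range_comp Subtype.val).trans Subtype.range_coe
  have hφ : φ ∈ Set.range e := hrange ▸ φ.mem_sub_self
  have hsize : φ.numSub = m + 1 := hm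
  refine ⟨Layered.model M e, Layered.ofWorld M e w, hsize ▸ Layered.sizeAtMost_model M e, ?_⟩
  exact (Layered.sat_iff (hrange ▸ φ.closed_sub) hφ _).trans
    (Layered.agree_toWorld_ofWorld w φ hφ)

end ITL

/-- The strong finite model property of `ITL^e`, with the explicit bound. The third conjunct says
that the bound is non-elementary: it eventually exceeds every tower of exponentials of fixed
height. -/
theorem mainTheorem1 :
    ∃ B : ℕ → ℕ,
      Computable B ∧
      (∀ s : ℕ, B s =
        ITL.boundQ (2 ^ (s + 1)) (s + 3) *
          (2 * ITL.boundE (2 ^ s) (s + 1) +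
            s * ITL.boundQ (2 ^ s) (s + 1) * ITL.boundE (2 ^ (s + 1)) (s + 3))) ∧
      (∀ k : ℕ, ∀ᶠ s : ℕ in Filter.atTop, ITL.tower k s < B s) ∧
      ∀ (P : Type u) (φ : ITL.Formula P),
        ((∃ M : ITL.Model.{u, v} P, M.Satisfies φ) →
          ∃ N : ITL.Model.{u, 0} P, N.SizeAtMost (B φ.numSub) ∧ N.Satisfies φ) ∧
        ((∃ M : ITL.Model.{u, v} P, M.Falsifies φ) →
          ∃ N : ITL.Model.{u, 0} P, N.SizeAtMost (B φ.numSub) ∧ N.Falsifies φ) := by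
  refine ⟨ITL.modelBound, ITL.computable_modelBound, fun _ => rfl,
    ITL.eventually_tower_lt_modelBound, fun P φ => ⟨?_, ?_⟩⟩
  · rintro ⟨M, w, hw⟩
    obtain ⟨N, ω, hN, h⟩ := ITL.exists_sizeAtMost_sat_iff φ M w
    exact ⟨N, hN, ω, h.2 hw⟩
  · rintro ⟨M, w, hw⟩
    obtain ⟨N, ω, hN, h⟩ := ITL.exists_sizeAtMost_sat_iff φ M w
    exact ⟨N, hN, ω, fun hω => hw (h.1 hω)⟩
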